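/- Let $M$ be a smooth (Hausdorff, finite-dimensional, without boundary) manifold, let $G$ be a finite-dimensional Lie group, and let $\pi\colon P\to M$ be a smooth principal $G$-bundle, with $G$ acting on $P$ from the right. Write $\chi(N)$ for the real Lie algebra of smooth vector fields on a manifold $N$. Let $V=\ker d\pi$ be the vertical distribution and let a connection be given, that is, a smooth $G$-invariant distribution $H$ on $P$ with $TP=V\oplus H$ (equivalently, $H=\ker\omega$ for a connection $1$-form $\omega$). Let $v$ and $h$ be the projectors of $TP$ onto $V$ and $H$, let $F=v-h$, and let $l_\omega\colon\chi(M)\to\chi(P)$ be the horizontal lift: $(l_\omega X)(p)$ is the unique vector in $H_p$ with $d\pi_p\big((l_\omega X)(p)\big)=X(\pi(p))$. Let $a,b$ be positive integers, let $\rho_{a,b}=\frac{a+\sqrt{a^2+4b}}{2}$, and let $$J=\frac a2 I+\frac{2\rho_{a,b}-a}{2}F,$$ which satisfies $J^2=aJ+bI$; this is the metallic structure on $P$ associated with the connection. Then $l_\omega$ is a morphism of real Lie algebras if and only if $J$ is integrable, i.e. if and only if its Nijenhuis tensor $$N_J(X,Y)=J^2[X,Y]+[JX,JY]-J[JX,Y]-J[X,JY]$$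 vanishes for all $X,Y\in\chi(P)$. -/

import Mathlib

open scoped Manifold ContDiff RightActions

noncomputable section

set_option linter.unusedSectionVars false

/-! ### Vector fields and (1,1)-tensor fields on a smooth manifold -/

section VectorFields

variable (E : Type*) [NormedAddCommGroup E] [NormedSpace ℝ E] [FiniteDimensional ℝ E]
  (M : Type*) [TopologicalSpace M] [ChartedSpace E M] [IsManifold 𝓘(ℝ, E) ∞ M]

instance tangentSpace_t2Space (x : M) : T2Space (TangentSpace 𝓘(ℝ, E) x) :=
  inferInstanceAs (T2Space E)

instance tangentSpace_finiteDimensional (x : M) :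
    FiniteDimensional ℝ (TangentSpace 𝓘(ℝ, E) x) :=
  inferInstanceAs (FiniteDimensional ℝ E)

/-- The space `χ(M)` of smooth vector fields on a manifold `M` modelled on `E`. -/
abbrev SmoothVectorField :=
  ContMDiffSection 𝓘(ℝ, E) E ∞ (fun x : M => TangentSpace 𝓘(ℝ, E) x)

/-- Smooth (1,1)-tensor fields on `M`, that is, smooth sections of `End(TM)`. -/
abbrev SmoothEndomorphismField :=
  ContMDiffSection 𝓘(ℝ, E) (E →L[ℝ] E) ∞
    (fun x : M => TangentSpace 𝓘(ℝ, E) x →L[ℝ] TangentSpace 𝓘(ℝ, E) x)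

variable {E M}

theorem smoothVectorField_mdifferentiableAt (X : SmoothVectorField E M) (x : M) :
    MDifferentiableAt 𝓘(ℝ, E) 𝓘(ℝ, E).tangent
      (fun y => (⟨y, X y⟩ : TangentBundle 𝓘(ℝ, E) M)) x :=
  X.contMDiff.mdifferentiable (by simp) x

theorem isManifold_minSmoothness_two : IsManifold 𝓘(ℝ, E) (minSmoothness ℝ 2) M := by
  rw [minSmoothness_of_isRCLikeNormedField]
  exact IsManifold.of_le (n := ∞) (WithTop.coe_le_coe.2 (le_top : (2 : ℕ∞) ≤ ⊤))

theorem isManifold_minSmoothness_three : IsManifold 𝓘(ℝ, E) (minSmoothness ℝ 3) M := by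
  rw [minSmoothness_of_isRCLikeNormedField]
  exact IsManifold.of_le (n := ∞) (WithTop.coe_le_coe.2 (le_top : (3 : ℕ∞) ≤ ⊤))

/-- The Lie bracket of two smooth vector fields. -/
def SmoothVectorField.bracket (X Y : SmoothVectorField E M) : SmoothVectorField E M where
  toFun := VectorField.mlieBracket 𝓘(ℝ, E) X Y
  contMDiff_toFun := by
    have : CompleteSpace E := FiniteDimensional.complete ℝ E
    have : IsManifold 𝓘(ℝ, E) (minSmoothness ℝ 2) M := isManifold_minSmoothness_two
    have : IsManifold 𝓘(ℝ, E) (((⊤ : ℕ∞) : WithTop ℕ∞) + 1) M :=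
      inferInstanceAs (IsManifold 𝓘(ℝ, E) ∞ M)
    exact ContDiff.mlieBracket_vectorField (m := ⊤) (n := ⊤) X.contMDiff Y.contMDiff
      (by rw [minSmoothness_of_isRCLikeNormedField]; exact le_rfl)

instance : Bracket (SmoothVectorField E M) (SmoothVectorField E M) :=
  ⟨SmoothVectorField.bracket⟩

theorem SmoothVectorField.bracket_apply (X Y : SmoothVectorField E M) (x : M) :
    ⁅X, Y⁆ x = VectorField.mlieBracket 𝓘(ℝ, E) X Y x := rfl

/-- `χ(M)` is a Lie ring under the Lie bracket of vector fields. -/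
instance : LieRing (SmoothVectorField E M) where
  add_lie X Y Z := by
    have : CompleteSpace E := FiniteDimensional.complete ℝ E
    ext x
    exact VectorField.mlieBracket_add_left (smoothVectorField_mdifferentiableAt X x)
      (smoothVectorField_mdifferentiableAt Y x)
  lie_add X Y Z := by
    have : CompleteSpace E := FiniteDimensional.complete ℝ E
    ext x
    exact VectorField.mlieBracket_add_right (smoothVectorField_mdifferentiableAt Y x)
      (smoothVectorField_mdifferentiableAt Z x)
  lie_self X := by
    ext x
    exact congrFun VectorField.mlieBracket_self x
  leibniz_lie X Y Z := by
    have : CompleteSpace E := FiniteDimensional.complete ℝ E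
    have : IsManifold 𝓘(ℝ, E) (minSmoothness ℝ 3) M := isManifold_minSmoothness_three
    have h : ∀ (W : SmoothVectorField E M) (x : M), ContMDiffAt 𝓘(ℝ, E) 𝓘(ℝ, E).tangent
        (minSmoothness ℝ 2) (fun y => (⟨y, W y⟩ : TangentBundle 𝓘(ℝ, E) M)) x := by
      intro W x
      rw [minSmoothness_of_isRCLikeNormedField]
      exact W.contMDiff.contMDiffAt.of_le (WithTop.coe_le_coe.2 (le_top : (2 : ℕ∞) ≤ ⊤))
    ext x
    exact VectorField.leibniz_identity_mlieBracket_apply (h X x) (h Y x) (h Z x)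

/-- `χ(M)` is a real Lie algebra under the Lie bracket of vector fields. -/
instance : LieAlgebra ℝ (SmoothVectorField E M) where
  lie_smul c X Y := by
    have : CompleteSpace E := FiniteDimensional.complete ℝ E
    ext x
    exact VectorField.mlieBracket_const_smul_right (smoothVectorField_mdifferentiableAt Y x)

namespace SmoothEndomorphismField

/-- The action `X ↦ J X` of a (1,1)-tensor field on vector fields. -/
def act (J : SmoothEndomorphismField E M) (X : SmoothVectorField E M) :
    SmoothVectorField E M where
  toFun x := J x (X x)
  contMDiff_toFun := ContMDiff.clm_bundle_apply J.contMDiff X.contMDiff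

/-- The Nijenhuis tensor
`N_J(X, Y) = J²[X, Y] + [J X, J Y] - J[J X, Y] - J[X, J Y]`. -/
def nijenhuis (J : SmoothEndomorphismField E M) (X Y : SmoothVectorField E M) :
    SmoothVectorField E M :=
  J.act (J.act ⁅X, Y⁆) + ⁅J.act X, J.act Y⁆ - J.act ⁅J.act X, Y⁆ - J.act ⁅X, J.act Y⁆

/-- The identity tensor field. -/
def identity : SmoothEndomorphismField E M where
  toFun x := ContinuousLinearMap.id ℝ (TangentSpace 𝓘(ℝ, E) x)
  contMDiff_toFun := by
    intro x₀
    rw [contMDiffAt_hom_bundle]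
    refine ⟨contMDiffAt_id, ?_⟩
    refine (contMDiffAt_const (c := ContinuousLinearMap.id ℝ E)).congr_of_eventuallyEq ?_
    have hx : (trivializationAt E (TangentSpace 𝓘(ℝ, E)) x₀).baseSet ∈ nhds x₀ :=
      (trivializationAt E (TangentSpace 𝓘(ℝ, E)) x₀).open_baseSet.mem_nhds
        (FiberBundle.mem_baseSet_trivializationAt' x₀)
    filter_upwards [hx] with x hx
    rw [ContinuousLinearMap.inCoordinates_eq hx hx]
    ext u
    simp

end SmoothEndomorphismField

variable (E M) in
/-- A metallic structure on `M` with positive integer parameters `a`, `b`: a (1,1)-tensor field `J`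
with `J² = a J + b I`. -/
structure MetallicStructure (a b : ℕ+) where
  /-- The underlying (1,1)-tensor field. -/
  tensor : SmoothEndomorphismField E M
  sq_eq : ∀ (x : M) (u : TangentSpace 𝓘(ℝ, E) x),
    tensor x (tensor x u) = (a : ℝ) • tensor x u + (b : ℝ) • u

/-- A metallic structure `J` is integrable if its Nijenhuis tensor vanishes identically. -/
def MetallicStructure.IsIntegrable {a b : ℕ+} (J : MetallicStructure E M a b) : Prop :=
  ∀ X Y : SmoothVectorField E M, J.tensor.nijenhuis X Y = 0

end VectorFields

/-- The metallic ratio `ρ_{a,b} = (a + √(a² + 4b)) / 2`. -/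
def metallicRatio (a b : ℕ+) : ℝ := ((a : ℝ) + √((a : ℝ) ^ 2 + 4 * (b : ℝ))) / 2

/-! ### Principal bundles and principal connections -/

section Principal

variable {EM EG EP : Type*}
  [NormedAddCommGroup EM] [NormedSpace ℝ EM] [FiniteDimensional ℝ EM]
  [NormedAddCommGroup EG] [NormedSpace ℝ EG] [FiniteDimensional ℝ EG]
  [NormedAddCommGroup EP] [NormedSpace ℝ EP] [FiniteDimensional ℝ EP]
  {M G P : Type*}
  [TopologicalSpace M] [ChartedSpace EM M] [IsManifold 𝓘(ℝ, EM) ∞ M]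
  [TopologicalSpace G] [ChartedSpace EG G] [Group G] [LieGroup 𝓘(ℝ, EG) ∞ G]
  [TopologicalSpace P] [ChartedSpace EP P] [IsManifold 𝓘(ℝ, EP) ∞ P]
  [MulAction Gᵐᵒᵖ P]

variable (EM EG EP M G P) in
/-- A smooth principal fibre bundle `P(π, M, G)`: the Lie group `G` acts smoothly on `P` from the
right (written `p <• g`), and around every point of the base there is a smooth `G`-equivariant
local trivialization `π⁻¹(U) ≃ U × G` over `U`. -/
structure PrincipalBundle where
  /-- The projection `π : P → M`. -/
  proj : P → M
  contMDiff_proj : ContMDiff 𝓘(ℝ, EP) 𝓘(ℝ, EM) ∞ proj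
  contMDiff_action : ContMDiff (𝓘(ℝ, EP).prod 𝓘(ℝ, EG)) 𝓘(ℝ, EP) ∞
    (fun x : P × G => x.1 <• x.2)
  exists_trivialization : ∀ x : M, ∃ (U : Set M) (e : OpenPartialHomeomorph P (M × G)),
    IsOpen U ∧ x ∈ U ∧ e.source = proj ⁻¹' U ∧ e.target = U ×ˢ Set.univ ∧
    (∀ p ∈ e.source, (e p).1 = proj p) ∧
    (∀ p ∈ e.source, ∀ g : G, e (p <• g) = ((e p).1, (e p).2 * g)) ∧
    ContMDiffOn 𝓘(ℝ, EP) (𝓘(ℝ, EM).prod 𝓘(ℝ, EG)) ∞ e e.source ∧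
    ContMDiffOn (𝓘(ℝ, EM).prod 𝓘(ℝ, EG)) 𝓘(ℝ, EP) ∞ e.symm e.target

namespace PrincipalBundle

variable (B : PrincipalBundle EM EG EP M G P)

/-- The differential `dπ` of the projection. -/
def dproj (p : P) : TangentSpace 𝓘(ℝ, EP) p →L[ℝ] TangentSpace 𝓘(ℝ, EM) (B.proj p) :=
  mfderiv 𝓘(ℝ, EP) 𝓘(ℝ, EM) B.proj p

/-- The vertical distribution `V = ker dπ`. -/
def vertical (p : P) : Submodule ℝ (TangentSpace 𝓘(ℝ, EP) p) :=
  LinearMap.ker (B.dproj p : TangentSpace 𝓘(ℝ, EP) p →ₗ[ℝ] TangentSpace 𝓘(ℝ, EM) (B.proj p))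

theorem dproj_mfderiv_symm {e : OpenPartialHomeomorph P (M × G)}
    (h₁ : ∀ p ∈ e.source, (e p).1 = B.proj p)
    (he : ContMDiffOn (𝓘(ℝ, EM).prod 𝓘(ℝ, EG)) 𝓘(ℝ, EP) ∞ e.symm e.target)
    (p : P) (hp : p ∈ e.source) (w : EM) :
    (mfderiv 𝓘(ℝ, EP) 𝓘(ℝ, EM) B.proj p : EP → EM)
      ((mfderiv (𝓘(ℝ, EM).prod 𝓘(ℝ, EG)) 𝓘(ℝ, EP) e.symm (e p) : EM × EG → EP) (w, 0)) = w := by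
  have hy : e p ∈ e.target := e.map_source hp
  have hsymm : MDifferentiableAt (𝓘(ℝ, EM).prod 𝓘(ℝ, EG)) 𝓘(ℝ, EP) e.symm (e p) :=
    (he.contMDiffAt (e.open_target.mem_nhds hy)).mdifferentiableAt (by simp)
  have hproj : ∀ q, MDifferentiableAt 𝓘(ℝ, EP) 𝓘(ℝ, EM) B.proj q :=
    B.contMDiff_proj.mdifferentiable (by simp)
  have hcomp := mfderiv_comp (e p) (hproj (e.symm (e p))) hsymm
  have hfst : (B.proj ∘ e.symm : M × G → M) =ᶠ[nhds (e p)] Prod.fst := by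
    filter_upwards [e.open_target.mem_nhds hy] with y hy
    rw [Function.comp_apply, ← h₁ _ (e.map_target hy), e.right_inv hy]
  rw [hfst.mfderiv_eq, mfderiv_fst] at hcomp
  have key : ∀ q, q = e.symm (e p) → (mfderiv 𝓘(ℝ, EP) 𝓘(ℝ, EM) B.proj q : EP → EM)
      ((mfderiv (𝓘(ℝ, EM).prod 𝓘(ℝ, EG)) 𝓘(ℝ, EP) e.symm (e p) : EM × EG → EP) (w, 0)) = w := by
    rintro _ rfl
    exact (DFunLike.congr_fun hcomp ((w, 0) : EM × EG)).symm
  exact key p (e.left_inv hp).symm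

theorem dproj_surjective (p : P) : Function.Surjective (B.dproj p) := by
  intro w
  obtain ⟨U, e, -, hx, hs, -, h₁, -, -, he⟩ := B.exists_trivialization (B.proj p)
  exact ⟨_, B.dproj_mfderiv_symm h₁ he p (by rw [hs]; exact hx) w⟩

end PrincipalBundle

/-- A connection in the principal bundle: a smooth, `G`-invariant distribution `H` on `P`
complementary to the vertical distribution. Smoothness of `H` is smoothness of the projector of
`TP = H ⊕ V` onto `H`. -/
structure PrincipalConnection (B : PrincipalBundle EM EG EP M G P) where
  /-- The horizontal distribution. -/
  horizontal : ∀ p : P, Submodule ℝ (TangentSpace 𝓘(ℝ, EP) p)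
  isCompl : ∀ p : P, IsCompl (horizontal p) (B.vertical p)
  invariant : ∀ (g : G) (p : P),
    (horizontal p).map (mfderiv 𝓘(ℝ, EP) 𝓘(ℝ, EP) (fun q : P => q <• g) p :
      TangentSpace 𝓘(ℝ, EP) p →ₗ[ℝ] TangentSpace 𝓘(ℝ, EP) (p <• g)) = horizontal (p <• g)
  smooth : ContMDiff 𝓘(ℝ, EP) (𝓘(ℝ, EP).prod 𝓘(ℝ, EP →L[ℝ] EP)) ∞
    (fun p : P => Bundle.TotalSpace.mk' (EP →L[ℝ] EP)
      (E := fun q : P => TangentSpace 𝓘(ℝ, EP) q →L[ℝ] TangentSpace 𝓘(ℝ, EP) q) p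
      (LinearMap.toContinuousLinearMap
        ((horizontal p).projection (B.vertical p) (isCompl p))))

namespace PrincipalConnection

variable {B : PrincipalBundle EM EG EP M G P} (C : PrincipalConnection B)

/-- The horizontal projector `h`. -/
def horizontalProjector : SmoothEndomorphismField EP P where
  toFun p := LinearMap.toContinuousLinearMap
    ((C.horizontal p).projection (B.vertical p) (C.isCompl p))
  contMDiff_toFun := C.smooth

/-- The vertical projector `v = I - h`. -/
def verticalProjector : SmoothEndomorphismField EP P :=
  SmoothEndomorphismField.identity - C.horizontalProjector

/-- The almost product structure `F = v - h` of the connection. -/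
def almostProductStructure : SmoothEndomorphismField EP P :=
  C.verticalProjector - C.horizontalProjector

/-- The metallic structure `J = (a/2) I + ((2ρ_{a,b} - a)/2) F` associated with the connection. -/
def metallicStructure (a b : ℕ+) : MetallicStructure EP P a b where
  tensor := ((a : ℝ) / 2) • SmoothEndomorphismField.identity +
    ((2 * metallicRatio a b - a) / 2) • C.almostProductStructure
  sq_eq p u := by
    have hh : C.horizontalProjector p (C.horizontalProjector p u) = C.horizontalProjector p u :=
      Submodule.projection_apply_of_mem_left (C.isCompl p)
        (Submodule.projection_apply_mem (C.isCompl p) u)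
    have hF : ∀ w, C.almostProductStructure p w = w - (2 : ℝ) • C.horizontalProjector p w := by
      intro w
      change (w - C.horizontalProjector p w) - C.horizontalProjector p w = _
      module
    have hJ : ∀ w, (((a : ℝ) / 2) • SmoothEndomorphismField.identity +
        ((2 * metallicRatio a b - a) / 2) • C.almostProductStructure :
          SmoothEndomorphismField EP P) p w =
        ((a : ℝ) / 2) • w + ((2 * metallicRatio a b - a) / 2) •
          (w - (2 : ℝ) • C.horizontalProjector p w) := by
      intro w
      rw [← hF]
      rfl
    have hs : (2 * metallicRatio a b - a) / 2 * ((2 * metallicRatio a b - a) / 2) =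
        (a : ℝ) ^ 2 / 4 + b := by
      have := Real.mul_self_sqrt (show (0 : ℝ) ≤ (a : ℝ) ^ 2 + 4 * (b : ℝ) by positivity)
      unfold metallicRatio
      linear_combination this / 4
    rw [hJ, hJ]
    simp only [map_add, map_sub, map_smul, hh]
    match_scalars
    · linear_combination hs
    · ring

theorem dproj_horizontalProjector (p : P) (u : TangentSpace 𝓘(ℝ, EP) p) :
    B.dproj p (C.horizontalProjector p u) = B.dproj p u := by
  have h : u - C.horizontalProjector p u ∈ B.vertical p := by
    have := Submodule.projection_eq_self_sub_projection (C.isCompl p) u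
    change u - (C.horizontal p).projection (B.vertical p) (C.isCompl p) u ∈ _
    rw [← this]
    exact Submodule.projection_apply_mem _ u
  have h' : B.dproj p (u - C.horizontalProjector p u) = 0 := h
  rw [map_sub, sub_eq_zero] at h'
  exact h'.symm

/-- The differential of the projection restricts to a linear isomorphism from the horizontal space
at `p` onto the tangent space of `M` at `π(p)`. -/
def horizontalEquiv (p : P) :
    C.horizontal p ≃ₗ[ℝ] TangentSpace 𝓘(ℝ, EM) (B.proj p) :=
  LinearEquiv.ofBijective
    ((B.dproj p : TangentSpace 𝓘(ℝ, EP) p →ₗ[ℝ] TangentSpace 𝓘(ℝ, EM) (B.proj p)).domRestrict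
      (C.horizontal p)) (by
    constructor
    · rw [← LinearMap.ker_eq_bot, LinearMap.ker_domRestrict, ← Submodule.disjoint_iff_comap_eq_bot]
      exact (C.isCompl p).disjoint
    · intro w
      obtain ⟨u, rfl⟩ := B.dproj_surjective p w
      refine ⟨⟨C.horizontalProjector p u, Submodule.projection_apply_mem (C.isCompl p) u⟩, ?_⟩
      exact C.dproj_horizontalProjector p u)

/-- The horizontal lift `l_ω : χ(M) → χ(P)`: the value of `l_ω X` at `p` is the unique horizontal
vector which `dπ` maps to `X(π(p))`. -/
def lift (X : SmoothVectorField EM M) : SmoothVectorField EP P where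
  toFun p := (C.horizontalEquiv p).symm (X (B.proj p))
  contMDiff_toFun := by
    intro p₀
    obtain ⟨U, e, -, hx, hs, -, h₁, -, hsm, he⟩ := B.exists_trivialization (B.proj p₀)
    have hp₀ : p₀ ∈ e.source := by rw [hs]; exact hx
    let I := 𝓘(ℝ, EM).prod 𝓘(ℝ, EG)
    -- a local lift of `X`, not necessarily horizontal
    let Y : (p : P) → TangentSpace 𝓘(ℝ, EP) p := fun p =>
      (mfderiv I 𝓘(ℝ, EP) e.symm (e p) : EM × EG → EP) ((X (B.proj p) : EM), 0)
    have hY : ContMDiffAt 𝓘(ℝ, EP) 𝓘(ℝ, EP).tangent ∞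
        (fun p => (⟨p, Y p⟩ : TangentBundle 𝓘(ℝ, EP) P)) p₀ := by
      have hsrc : e.source ∈ nhds p₀ := e.open_source.mem_nhds hp₀
      have hX : ContMDiffAt 𝓘(ℝ, EP) 𝓘(ℝ, EM).tangent ∞
          (fun p => (⟨B.proj p, X (B.proj p)⟩ : TangentBundle 𝓘(ℝ, EM) M)) p₀ :=
        (X.contMDiff.comp B.contMDiff_proj).contMDiffAt
      have hZ : ContMDiffAt 𝓘(ℝ, EP) 𝓘(ℝ, EG).tangent ∞
          (fun p => (⟨(e p).2, 0⟩ : TangentBundle 𝓘(ℝ, EG) G)) p₀ :=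
        ((Bundle.contMDiff_zeroSection ℝ (TangentSpace 𝓘(ℝ, EG) : G → Type _)).contMDiffAt).comp p₀
          ((hsm.contMDiffAt hsrc).snd)
      have hXZ := (contMDiff_equivTangentBundleProd_symm (n := ∞) (I := 𝓘(ℝ, EM)) (M := M)
        (I' := 𝓘(ℝ, EG)) (M' := G)).contMDiffAt.comp p₀ (hX.prodMk hZ)
      have hT := (he.contMDiffOn_tangentMapWithin (m := ∞) le_rfl e.open_target.uniqueMDiffOn)
      have hbase : ∀ p ∈ e.source, ((B.proj p, (e p).2) : M × G) = e p := fun p hp =>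
        Prod.ext (h₁ p hp).symm rfl
      have hnhds : (Bundle.TotalSpace.proj ⁻¹' e.target : Set (TangentBundle I (M × G))) ∈
          nhds ((equivTangentBundleProd 𝓘(ℝ, EM) M 𝓘(ℝ, EG) G).symm
            (⟨B.proj p₀, X (B.proj p₀)⟩, ⟨(e p₀).2, 0⟩)) := by
        refine (e.open_target.preimage
          (FiberBundle.continuous_proj (EM × EG) (TangentSpace I))).mem_nhds ?_
        change ((B.proj p₀, (e p₀).2) : M × G) ∈ e.target
        rw [hbase p₀ hp₀]
        exact e.map_source hp₀
      refine ((hT.contMDiffAt hnhds).comp p₀ hXZ).congr_of_eventuallyEq ?_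
      filter_upwards [hsrc] with p hp
      have key : ∀ q : M × G, q = e p → (⟨p, Y p⟩ : TangentBundle 𝓘(ℝ, EP) P) =
          tangentMapWithin I 𝓘(ℝ, EP) e.symm e.target
            ⟨q, ((X (B.proj p) : EM), (0 : EG))⟩ := by
        rintro _ rfl
        refine Bundle.TotalSpace.ext (e.left_inv hp).symm (heq_of_eq ?_)
        change Y p = (mfderivWithin I 𝓘(ℝ, EP) e.symm e.target (e p) : EM × EG → EP) _
        rw [mfderivWithin_of_isOpen e.open_target (e.map_source hp)]
      exact key _ (hbase p hp)
    have hl : (fun p => (⟨p, (C.horizontalEquiv p).symm (X (B.proj p))⟩ :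
        TangentBundle 𝓘(ℝ, EP) P)) =ᶠ[nhds p₀]
        fun p => (⟨p, C.horizontalProjector p (Y p)⟩ : TangentBundle 𝓘(ℝ, EP) P) := by
      filter_upwards [e.open_source.mem_nhds hp₀] with p hp
      congr 1
      have hmem : C.horizontalProjector p (Y p) ∈ C.horizontal p :=
        Submodule.projection_apply_mem (C.isCompl p) (Y p)
      have : (C.horizontalEquiv p).symm (X (B.proj p)) = ⟨_, hmem⟩ := by
        rw [LinearEquiv.symm_apply_eq]
        exact ((C.dproj_horizontalProjector p (Y p)).trans
          (B.dproj_mfderiv_symm h₁ he p hp (X (B.proj p)))).symm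
      rw [this]
    exact (ContMDiffAt.clm_bundle_apply C.horizontalProjector.contMDiff.contMDiffAt
      hY).congr_of_eventuallyEq hl

end PrincipalConnection

end Principal

end

/-! Since `F = I - 2h`, the metallic structure is `J = ρ I + (a - 2ρ) h`, and bilinearity gives `N_J
= (a - 2ρ)² N_h` with `a - 2ρ ≠ 0`. Integrability of `J` is therefore the vanishing of `N_h`.

The fields killed by `h` are those `π`-related to zero, so they are closed under brackets. Expanding
`h[X - hX, Y - hY] = 0` reduces `N_h(X, Y)` to the vertical part of `[hX, hY]`, the curvature of the
connection. For lifts, `[lX, lY]` is `π`-related to `[X, Y]`, so its horizontal part is `l[X, Y]`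
and `N_h(lX, lY) = [lX, lY] - l[X, Y]`. Hence `N_h = 0` makes `l` preserve brackets. Conversely, the
vertical part of `[hX, hY]` at `p` depends only on `hX` and `hY` at `p`, and every horizontal vector
is a value of some lift.

The main ingredients are `mfderiv_mlieBracket_of_related`, `lie_act_eq_of_apply_eq` and
`nijenhuis_horizontalProjector`. -/

set_option linter.unusedSectionVars false

/-! ### Brackets of vector fields related by a smooth map. -/

section RelatedVectorFields

open Filter Topology VectorField

variable {E E' : Type*} [NormedAddCommGroup E] [NormedSpace ℝ E]
  [NormedAddCommGroup E'] [NormedSpace ℝ E']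

/-- The Lie bracket respects vector fields related by a map between normed spaces. -/
theorem fderiv_lieBracket_of_related {F : E → E'} {v w : E → E} {v' w' : E' → E'} {x : E}
    (hF : ContDiffAt ℝ 2 F x) (hv : DifferentiableAt ℝ v x) (hw : DifferentiableAt ℝ w x)
    (hv' : DifferentiableAt ℝ v' (F x)) (hw' : DifferentiableAt ℝ w' (F x))
    (hvF : ∀ᶠ y in 𝓝 x, fderiv ℝ F y (v y) = v' (F y))
    (hwF : ∀ᶠ y in 𝓝 x, fderiv ℝ F y (w y) = w' (F y)) :
    fderiv ℝ F x (lieBracket ℝ v w x) = lieBracket ℝ v' w' (F x) := by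
  have hFx : DifferentiableAt ℝ F x := hF.differentiableAt (by simp)
  have hv₁ : (fun y => fderiv ℝ F y (v y)) =ᶠ[𝓝 x] v' ∘ F := hvF
  have hw₁ : (fun y => fderiv ℝ F y (w y)) =ᶠ[𝓝 x] w' ∘ F := hwF
  -- Symmetry of `D²F` gives `DF[v, w] = D(DF w) v - D(DF v) w`; relatedness then replaces `DF v`
  -- and `DF w` by `v' ∘ F` and `w' ∘ F`.
  rw [fderiv_apply_lieBracket hF (by simp) hw hv, hv₁.fderiv_eq, hw₁.fderiv_eq,
    fderiv_comp x hv' hFx, fderiv_comp x hw' hFx, ContinuousLinearMap.comp_apply,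
    ContinuousLinearMap.comp_apply, hvF.self_of_nhds, hwF.self_of_nhds, lieBracket]

variable [CompleteSpace E] [CompleteSpace E']
  {M M' : Type*} [TopologicalSpace M] [ChartedSpace E M] [IsManifold 𝓘(ℝ, E) ∞ M]
  [TopologicalSpace M'] [ChartedSpace E' M'] [IsManifold 𝓘(ℝ, E') ∞ M']

/-- The coordinate expression of a vector field in the chart at `x`. -/
noncomputable def coordVectorField (x : M) (V : (y : M) → TangentSpace 𝓘(ℝ, E) y) : E → E :=
  mpullbackWithin 𝓘(ℝ, E) 𝓘(ℝ, E) (extChartAt 𝓘(ℝ, E) x).symm V (Set.range 𝓘(ℝ, E))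

theorem isManifold_two_of_infty : IsManifold 𝓘(ℝ, E) 2 M :=
  IsManifold.of_le (n := ∞) (WithTop.coe_le_coe.2 (le_top : (2 : ℕ∞) ≤ ⊤))

theorem isManifold_one_of_infty : IsManifold 𝓘(ℝ, E) 1 M :=
  IsManifold.of_le (n := ∞) (WithTop.coe_le_coe.2 (le_top : (1 : ℕ∞) ≤ ⊤))

theorem coordVectorField_extChartAt {x y : M} (V : (y : M) → TangentSpace 𝓘(ℝ, E) y)
    (hy : y ∈ (extChartAt 𝓘(ℝ, E) x).source) :
    coordVectorField x V (extChartAt 𝓘(ℝ, E) x y) =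
      mfderiv 𝓘(ℝ, E) 𝓘(ℝ, E) (extChartAt 𝓘(ℝ, E) x) y (V y) := by
  have : IsManifold 𝓘(ℝ, E) 1 M := isManifold_one_of_infty
  have hy' := (extChartAt 𝓘(ℝ, E) x).map_source hy
  unfold coordVectorField
  rw [mpullbackWithin_apply]
  rw [ContinuousLinearMap.inverse_eq
    (mfderivWithin_extChartAt_symm_comp_mfderiv_extChartAt hy')
    (mfderiv_extChartAt_comp_mfderivWithin_extChartAt_symm hy')]
  -- The field is evaluated at `φ.symm (φ y)`, equal to `y` only propositionally; a general `z`
  -- avoids transport between tangent spaces.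
  have key : ∀ z, z = y → (mfderiv 𝓘(ℝ, E) 𝓘(ℝ, E) (extChartAt 𝓘(ℝ, E) x) z : E → E) (V z : E) =
      (mfderiv 𝓘(ℝ, E) 𝓘(ℝ, E) (extChartAt 𝓘(ℝ, E) x) y : E → E) (V y) := by
    rintro _ rfl; rfl
  exact key _ ((extChartAt 𝓘(ℝ, E) x).left_inv hy)

theorem differentiableAt_coordVectorField {x : M} {V : (y : M) → TangentSpace 𝓘(ℝ, E) y}
    (hV : MDifferentiableAt 𝓘(ℝ, E) 𝓘(ℝ, E).tangent
      (fun y => (⟨y, V y⟩ : TangentBundle 𝓘(ℝ, E) M)) x) :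
    DifferentiableAt ℝ (coordVectorField x V) (extChartAt 𝓘(ℝ, E) x x) := by
  have : IsManifold 𝓘(ℝ, E) 2 M := isManifold_two_of_infty
  have h := MDifferentiableWithinAt.differentiableWithinAt_mpullbackWithin_vectorField
    (s := Set.univ) hV.mdifferentiableWithinAt
  rw [Set.preimage_univ, Set.univ_inter, ModelWithCorners.range_eq_univ] at h
  rw [coordVectorField, ModelWithCorners.range_eq_univ]
  exact differentiableWithinAt_univ.1 h

/-- The manifold bracket is defined by pulling back the bracket of the coordinate fields through the
chart; the chart's derivative undoes that pullback. -/
theorem mfderiv_extChartAt_mlieBracket (x : M) (V W : (y : M) → TangentSpace 𝓘(ℝ, E) y) :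
    mfderiv 𝓘(ℝ, E) 𝓘(ℝ, E) (extChartAt 𝓘(ℝ, E) x) x (mlieBracket 𝓘(ℝ, E) V W x) =
      lieBracket ℝ (coordVectorField x V) (coordVectorField x W) (extChartAt 𝓘(ℝ, E) x x) := by
  have : IsManifold 𝓘(ℝ, E) 1 M := isManifold_one_of_infty
  rw [← mlieBracketWithin_univ, mlieBracketWithin_apply]
  obtain ⟨e, he⟩ := isInvertible_mfderiv_extChartAt (mem_extChartAt_source (I := 𝓘(ℝ, E)) x)
  rw [← he, ContinuousLinearMap.inverse_equiv]
  refine (e.apply_symm_apply _).trans ?_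
  rw [Set.preimage_univ, Set.univ_inter, coordVectorField, coordVectorField,
    ModelWithCorners.range_eq_univ]
  exact congrFun (lieBracketWithin_univ (𝕜 := ℝ) (E := E)) (extChartAt 𝓘(ℝ, E) x x)

/-- The Lie bracket respects vector fields related by a smooth map of manifolds. -/
theorem mfderiv_mlieBracket_of_related {f : M → M'} (hf : ContMDiff 𝓘(ℝ, E) 𝓘(ℝ, E') ∞ f)
    {V W : (y : M) → TangentSpace 𝓘(ℝ, E) y} {V' W' : (y : M') → TangentSpace 𝓘(ℝ, E') y} {x : M}
    (hV : MDifferentiableAt 𝓘(ℝ, E) 𝓘(ℝ, E).tangent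
      (fun y => (⟨y, V y⟩ : TangentBundle 𝓘(ℝ, E) M)) x)
    (hW : MDifferentiableAt 𝓘(ℝ, E) 𝓘(ℝ, E).tangent
      (fun y => (⟨y, W y⟩ : TangentBundle 𝓘(ℝ, E) M)) x)
    (hV' : MDifferentiableAt 𝓘(ℝ, E') 𝓘(ℝ, E').tangent
      (fun y => (⟨y, V' y⟩ : TangentBundle 𝓘(ℝ, E') M')) (f x))
    (hW' : MDifferentiableAt 𝓘(ℝ, E') 𝓘(ℝ, E').tangent
      (fun y => (⟨y, W' y⟩ : TangentBundle 𝓘(ℝ, E') M')) (f x))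
    (hVV' : ∀ y, mfderiv 𝓘(ℝ, E) 𝓘(ℝ, E') f y (V y) = V' (f y))
    (hWW' : ∀ y, mfderiv 𝓘(ℝ, E) 𝓘(ℝ, E') f y (W y) = W' (f y)) :
    mfderiv 𝓘(ℝ, E) 𝓘(ℝ, E') f x (mlieBracket 𝓘(ℝ, E) V W x) =
      mlieBracket 𝓘(ℝ, E') V' W' (f x) := by
  have : IsManifold 𝓘(ℝ, E) 1 M := isManifold_one_of_infty
  have : IsManifold 𝓘(ℝ, E') 1 M' := isManifold_one_of_infty
  let φ := extChartAt 𝓘(ℝ, E) x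
  let ψ := extChartAt 𝓘(ℝ, E') (f x)
  let F : E → E' := ψ ∘ f ∘ φ.symm
  have hφx : φ.symm (φ x) = x := extChartAt_to_inv x
  have hFx : F (φ x) = ψ (f x) := congrArg (ψ ∘ f) hφx
  -- Only finite orders of smoothness at a point spread to a neighbourhood. Order 1 serves the chain
  -- rule nearby, order 2 the symmetry of `D²F`.
  have hFn : ∀ n : ℕ, ContDiffAt ℝ n F (φ x) := by
    intro n
    have h := (contMDiffAt_iff.1 (hf.contMDiffAt (x := x))).2
    rw [ModelWithCorners.range_eq_univ, contDiffWithinAt_univ] at h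
    exact h.of_le (WithTop.coe_le_coe.2 (le_top : (n : ℕ∞) ≤ ⊤))
  -- the chain rule for `F ∘ φ = ψ ∘ f` near `x`
  have chain : ∀ᶠ y in 𝓝 x, ∀ u : E,
      fderiv ℝ F (φ y) ((mfderiv 𝓘(ℝ, E) 𝓘(ℝ, E) φ y : E → E) u) =
        (mfderiv 𝓘(ℝ, E') 𝓘(ℝ, E') ψ (f y) : E' → E')
          ((mfderiv 𝓘(ℝ, E) 𝓘(ℝ, E') f y : E → E') u) := by
    have h1 : ∀ᶠ y in 𝓝 x, DifferentiableAt ℝ F (φ y) := by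
      have h := ((hFn 1).eventually (by simp)).mono fun z hz => hz.differentiableAt (by simp)
      exact (continuousAt_extChartAt x).eventually h
    have h2 : ∀ᶠ y in 𝓝 x, f y ∈ (chartAt E' (f x)).source :=
      hf.continuous.continuousAt.eventually (chart_source_mem_nhds E' (f x))
    have h3 : ∀ᶠ y in 𝓝 x, F ∘ φ =ᶠ[𝓝 y] ψ ∘ f := by
      refine Filter.Eventually.eventually_nhds ?_
      filter_upwards [extChartAt_source_mem_nhds (I := 𝓘(ℝ, E)) x] with y hy
      exact congrArg (ψ ∘ f) (φ.left_inv hy)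
    filter_upwards [h1, h2, h3, chart_source_mem_nhds E x] with y h1 h2 h3 h4 u
    have hl := mfderiv_comp y h1.mdifferentiableAt (mdifferentiableAt_extChartAt (I := 𝓘(ℝ, E)) h4)
    have hr := mfderiv_comp y (mdifferentiableAt_extChartAt (I := 𝓘(ℝ, E')) h2)
      (hf.mdifferentiable (by simp) y)
    have := hl.symm.trans ((h3.mfderiv_eq).trans hr)
    rw [mfderiv_eq_fderiv] at this
    exact DFunLike.congr_fun this u
  -- Relatedness along `f` becomes relatedness along `F`; composing with `φ.symm` turns
  -- neighbourhoods of `x` into neighbourhoods of `φ x`.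
  have coord : ∀ (X : (y : M) → TangentSpace 𝓘(ℝ, E) y)
      (X' : (y : M') → TangentSpace 𝓘(ℝ, E') y),
      (∀ y, mfderiv 𝓘(ℝ, E) 𝓘(ℝ, E') f y (X y) = X' (f y)) →
      ∀ᶠ z in 𝓝 (φ x), fderiv ℝ F z (coordVectorField x X z) =
        coordVectorField (f x) X' (F z) := by
    intro X X' hX
    have h2 : ∀ᶠ y in 𝓝 x, f y ∈ ψ.source :=
      hf.continuous.continuousAt.eventually (extChartAt_source_mem_nhds (f x))
    have h : ∀ᶠ y in 𝓝 x, fderiv ℝ F (φ y) (coordVectorField x X (φ y)) =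
        coordVectorField (f x) X' (F (φ y)) := by
      filter_upwards [chain, h2, extChartAt_source_mem_nhds (I := 𝓘(ℝ, E)) x] with y h1 h2 h3
      have hFy : F (φ y) = ψ (f y) := congrArg (ψ ∘ f) (φ.left_inv h3)
      rw [hFy, coordVectorField_extChartAt X' h2, coordVectorField_extChartAt X h3, ← hX]
      exact h1 (X y)
    have ht : Tendsto φ.symm (𝓝 (φ x)) (𝓝 x) := by
      simpa [ContinuousAt, hφx, φ] using continuousAt_extChartAt_symm (I := 𝓘(ℝ, E)) x
    filter_upwards [ht.eventually h, extChartAt_target_mem_nhds (I := 𝓘(ℝ, E)) x] with z hz hz'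
    rwa [φ.right_inv hz'] at hz
  -- `dψ` is injective at `f x`, so both sides may be compared in the chart `ψ`.
  obtain ⟨e, he⟩ := isInvertible_mfderiv_extChartAt (mem_extChartAt_source (I := 𝓘(ℝ, E')) (f x))
  apply e.injective
  have hinj := chain.self_of_nhds (mlieBracket 𝓘(ℝ, E) V W x)
  have hb := mfderiv_extChartAt_mlieBracket (f x) V' W'
  have ha := mfderiv_extChartAt_mlieBracket x V W
  rw [← he] at hb
  have key := fderiv_lieBracket_of_related (hFn 2) (differentiableAt_coordVectorField hV)
    (differentiableAt_coordVectorField hW)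
    (by rw [hFx]; exact differentiableAt_coordVectorField hV')
    (by rw [hFx]; exact differentiableAt_coordVectorField hW') (coord V V' hVV') (coord W W' hWW')
  rw [hFx] at key
  refine Eq.trans ?_ (key.trans hb.symm)
  refine Eq.trans ?_ (hinj.symm.trans (congrArg (fderiv ℝ F (φ x)) ha))
  exact DFunLike.congr_fun he _

end RelatedVectorFields

/-! ### Global extension of tangent vectors. -/

section VectorFieldExtension

variable {E : Type*} [NormedAddCommGroup E] [NormedSpace ℝ E] [FiniteDimensional ℝ E]
  {M : Type*} [TopologicalSpace M] [ChartedSpace E M] [IsManifold 𝓘(ℝ, E) ∞ M]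

/-- On a Hausdorff manifold, every tangent vector is the value of a smooth vector field. -/
theorem SmoothVectorField.exists_apply_eq [T2Space M] (x : M) (u : TangentSpace 𝓘(ℝ, E) x) :
    ∃ X : SmoothVectorField E M, X x = u := by
  obtain ⟨s, hs, hsm⟩ := FiberBundle.exists_contMDiffOn_extend 𝓘(ℝ, E) E (k := ∞) u
  obtain ⟨t, hts, ht, hxt⟩ := mem_nhds_iff.1 hs
  -- A bump function supported where the local extension is smooth: the product extends by zero and
  -- keeps the value at `x`, where `f = 1`.
  obtain ⟨f, -, hf⟩ :=
    (SmoothBumpFunction.nhds_basis_tsupport (I := 𝓘(ℝ, E)) x).mem_iff.1 (ht.mem_nhds hxt)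
  have hsmooth := ContMDiffOn.smul_section_of_tsupport (f.contMDiff.contMDiffOn (s := t)) ht
    hf (hsm.mono hts)
  refine ⟨⟨_, hsmooth⟩, ?_⟩
  change f x • FiberBundle.extend E u x = u
  rw [f.eq_one, one_smul, FiberBundle.extend_apply_self]

end VectorFieldExtension

/-! ### Nijenhuis tensors and tensoriality. -/

namespace SmoothEndomorphismField

variable {E : Type*} [NormedAddCommGroup E] [NormedSpace ℝ E] [FiniteDimensional ℝ E]
  {M : Type*} [TopologicalSpace M] [ChartedSpace E M] [IsManifold 𝓘(ℝ, E) ∞ M]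

theorem act_add (J : SmoothEndomorphismField E M) (X Y : SmoothVectorField E M) :
    J.act (X + Y) = J.act X + J.act Y := by
  ext x
  exact map_add (J x) (X x) (Y x)

theorem act_sub (J : SmoothEndomorphismField E M) (X Y : SmoothVectorField E M) :
    J.act (X - Y) = J.act X - J.act Y := by
  ext x
  exact map_sub (J x) (X x) (Y x)

theorem act_smul (J : SmoothEndomorphismField E M) (c : ℝ) (X : SmoothVectorField E M) :
    J.act (c • X) = c • J.act X := by
  ext x
  exact map_smul (J x) c (X x)

/-- The Nijenhuis tensor of an affine combination `r I + s H` is `s²` times that of `H`. -/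
theorem nijenhuis_eq_smul {J H : SmoothEndomorphismField E M} {r s : ℝ}
    (hJ : ∀ X, J.act X = r • X + s • H.act X) (X Y : SmoothVectorField E M) :
    J.nijenhuis X Y = s ^ 2 • H.nijenhuis X Y := by
  -- The `r²` and `r s` contributions cancel among the four terms.
  simp only [nijenhuis, hJ, add_lie, lie_add, smul_lie, lie_smul, act_add, act_smul]
  module

/-- For every idempotent tensor field `H`, the bracket `[H X, H Y]` modulo the image of `H` is tensorial. -/
theorem lie_act_eq_of_apply_eq (H : SmoothEndomorphismField E M)
    (hH : ∀ x (u : TangentSpace 𝓘(ℝ, E) x), H x (H x u) = H x u) {x : M}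
    {X X' Y Y' : SmoothVectorField E M} (hX : X x = X' x) (hY : Y x = Y' x) :
    ⁅H.act X, H.act Y⁆ x - H x (⁅H.act X, H.act Y⁆ x) =
      ⁅H.act X', H.act Y'⁆ x - H x (⁅H.act X', H.act Y'⁆ x) := by
  have : CompleteSpace E := FiniteDimensional.complete ℝ E
  have : IsManifold 𝓘(ℝ, E) 2 M := isManifold_two_of_infty
  have : IsManifold 𝓘(ℝ, E) (minSmoothness ℝ 2) M := isManifold_minSmoothness_two
  -- The Leibniz rule makes `[f Hσ, Hτ]` differ from `f [Hσ, Hτ]` by a multiple of `Hσ`, which `T =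
  -- id - H` kills.
  let T : TangentSpace 𝓘(ℝ, E) x →ₗ[ℝ] TangentSpace 𝓘(ℝ, E) x :=
    LinearMap.id - (H x : TangentSpace 𝓘(ℝ, E) x →ₗ[ℝ] TangentSpace 𝓘(ℝ, E) x)
  have hT : ∀ u, T (H x u) = 0 := fun u => sub_eq_zero.2 (hH x u).symm
  -- The tensoriality criterion ranges over sections merely differentiable at `x`, so `H` must act
  -- on arbitrary sections.
  let A : (∀ y : M, TangentSpace 𝓘(ℝ, E) y) → ∀ y : M, TangentSpace 𝓘(ℝ, E) y :=
    fun σ y => H y (σ y)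
  have hA : ∀ {σ : ∀ y : M, TangentSpace 𝓘(ℝ, E) y},
      MDifferentiableAt 𝓘(ℝ, E) 𝓘(ℝ, E).tangent
        (fun y => (⟨y, σ y⟩ : TangentBundle 𝓘(ℝ, E) M)) x →
      MDifferentiableAt 𝓘(ℝ, E) 𝓘(ℝ, E).tangent
        (fun y => (⟨y, A σ y⟩ : TangentBundle 𝓘(ℝ, E) M)) x := fun hσ =>
    MDifferentiableAt.clm_bundle_apply (H.contMDiff.mdifferentiable (by simp) x) hσ
  have hAsmul : ∀ (f : M → ℝ) σ, A (f • σ) = f • A σ := fun f σ =>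
    funext fun y => map_smul (H y) (f y) (σ y)
  have hAadd : ∀ σ σ', A (σ + σ') = A σ + A σ' := fun σ σ' =>
    funext fun y => map_add (H y) (σ y) (σ' y)
  let Φ : (∀ y : M, TangentSpace 𝓘(ℝ, E) y) → (∀ y : M, TangentSpace 𝓘(ℝ, E) y) →
      TangentSpace 𝓘(ℝ, E) x := fun σ τ => T (VectorField.mlieBracket 𝓘(ℝ, E) (A σ) (A τ) x)
  refine TensorialAt.pointwise₂ (I := 𝓘(ℝ, E)) (F := E) (F' := E) (Φ := Φ)
    (fun τ _ => ⟨fun {f σ} hf hσ => ?_, fun {σ σ'} hσ hσ' => ?_⟩)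
    (fun σ _ => ⟨fun {f τ} hf hτ => ?_, fun {τ τ'} hτ hτ' => ?_⟩)
    (smoothVectorField_mdifferentiableAt X x) (smoothVectorField_mdifferentiableAt X' x)
    (smoothVectorField_mdifferentiableAt Y x) (smoothVectorField_mdifferentiableAt Y' x) hX hY
  · change T _ = f x • T _
    rw [hAsmul, VectorField.mlieBracket_smul_left hf (hA hσ), map_add, map_smul, map_smul, hT,
      smul_zero, zero_add]
  · change T _ = T _ + T _
    rw [hAadd, VectorField.mlieBracket_add_left (hA hσ) (hA hσ'), map_add]
  · change T _ = f x • T _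
    rw [hAsmul, VectorField.mlieBracket_smul_right hf (hA hτ), map_add, map_smul, map_smul, hT,
      smul_zero, zero_add]
  · change T _ = T _ + T _
    rw [hAadd, VectorField.mlieBracket_add_right (hA hτ) (hA hτ'), map_add]

end SmoothEndomorphismField

/-! ### Horizontal lifts and curvature. -/

namespace PrincipalConnection

variable {EM EG EP : Type*}
  [NormedAddCommGroup EM] [NormedSpace ℝ EM] [FiniteDimensional ℝ EM]
  [NormedAddCommGroup EG] [NormedSpace ℝ EG] [FiniteDimensional ℝ EG]
  [NormedAddCommGroup EP] [NormedSpace ℝ EP] [FiniteDimensional ℝ EP]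
  {M G P : Type*}
  [TopologicalSpace M] [ChartedSpace EM M] [IsManifold 𝓘(ℝ, EM) ∞ M]
  [TopologicalSpace G] [ChartedSpace EG G] [Group G] [LieGroup 𝓘(ℝ, EG) ∞ G]
  [TopologicalSpace P] [ChartedSpace EP P] [IsManifold 𝓘(ℝ, EP) ∞ P]
  [MulAction Gᵐᵒᵖ P] {B : PrincipalBundle EM EG EP M G P} (C : PrincipalConnection B)

theorem horizontalProjector_idem (p : P) (u : TangentSpace 𝓘(ℝ, EP) p) :
    C.horizontalProjector p (C.horizontalProjector p u) = C.horizontalProjector p u :=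
  Submodule.projection_apply_of_mem_left (C.isCompl p)
    (Submodule.projection_apply_mem (C.isCompl p) u)

/-- Both kernels are the vertical space, so horizontal parts can be compared after projection to
`M`, where brackets of projectable fields are known. -/
theorem horizontalProjector_eq_zero_iff {p : P} {u : TangentSpace 𝓘(ℝ, EP) p} :
    C.horizontalProjector p u = 0 ↔ B.dproj p u = 0 :=
  ⟨fun h => by rw [← C.dproj_horizontalProjector, h, map_zero],
    fun h => Submodule.projection_apply_of_mem_right (C.isCompl p) h⟩

theorem horizontalProjector_eq_of_dproj_eq {p : P} {u w : TangentSpace 𝓘(ℝ, EP) p}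
    (h : B.dproj p u = B.dproj p w) : C.horizontalProjector p u = C.horizontalProjector p w := by
  rw [← sub_eq_zero, ← map_sub, horizontalProjector_eq_zero_iff, map_sub, h, sub_self]

theorem horizontalProjector_lift (X : SmoothVectorField EM M) (p : P) :
    C.horizontalProjector p (C.lift X p) = C.lift X p :=
  Submodule.projection_apply_of_mem_left (C.isCompl p)
    ((C.horizontalEquiv p).symm (X (B.proj p))).2

theorem dproj_lift (X : SmoothVectorField EM M) (p : P) :
    B.dproj p (C.lift X p) = X (B.proj p) :=
  (C.horizontalEquiv p).apply_symm_apply (X (B.proj p))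

theorem act_lift (X : SmoothVectorField EM M) : C.horizontalProjector.act (C.lift X) = C.lift X :=
  ContMDiffSection.ext (C.horizontalProjector_lift X)

theorem lift_add (X Y : SmoothVectorField EM M) : C.lift (X + Y) = C.lift X + C.lift Y := by
  ext p
  exact congrArg Subtype.val (map_add (C.horizontalEquiv p).symm (X (B.proj p)) (Y (B.proj p)))

theorem lift_smul (c : ℝ) (X : SmoothVectorField EM M) : C.lift (c • X) = c • C.lift X := by
  ext p
  exact congrArg Subtype.val (map_smul (C.horizontalEquiv p).symm c (X (B.proj p)))

/-- If `X` and `Y` are projectable onto `X'` and `Y'`, then `[X, Y]` is projectable onto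
`[X', Y']`. -/
theorem dproj_lie {X Y : SmoothVectorField EP P} {X' Y' : SmoothVectorField EM M}
    (hX : ∀ p, B.dproj p (X p) = X' (B.proj p)) (hY : ∀ p, B.dproj p (Y p) = Y' (B.proj p))
    (p : P) : B.dproj p (⁅X, Y⁆ p) = ⁅X', Y'⁆ (B.proj p) := by
  have : CompleteSpace EP := FiniteDimensional.complete ℝ EP
  have : CompleteSpace EM := FiniteDimensional.complete ℝ EM
  exact mfderiv_mlieBracket_of_related B.contMDiff_proj
    (smoothVectorField_mdifferentiableAt X p) (smoothVectorField_mdifferentiableAt Y p)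
    (smoothVectorField_mdifferentiableAt X' _) (smoothVectorField_mdifferentiableAt Y' _) hX hY

/-- The horizontal part of `[l X, l Y]` is `l [X, Y]`. -/
theorem act_lie_lift (X Y : SmoothVectorField EM M) :
    C.horizontalProjector.act ⁅C.lift X, C.lift Y⁆ = C.lift ⁅X, Y⁆ := by
  -- A lift is its own horizontal part; both sides become values of `h`, so comparing their
  -- projections suffices.
  rw [← C.act_lift ⁅X, Y⁆]
  ext p
  refine C.horizontalProjector_eq_of_dproj_eq ?_
  rw [dproj_lie (C.dproj_lift X) (C.dproj_lift Y), C.dproj_lift]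

/-- The vertical distribution is involutive. -/
theorem act_lie_eq_zero {X Y : SmoothVectorField EP P} (hX : C.horizontalProjector.act X = 0)
    (hY : C.horizontalProjector.act Y = 0) : C.horizontalProjector.act ⁅X, Y⁆ = 0 := by
  ext p
  refine C.horizontalProjector_eq_zero_iff.2 ?_
  rw [dproj_lie (X' := 0) (Y' := 0)
    (fun q => C.horizontalProjector_eq_zero_iff.1 (DFunLike.congr_fun hX q))
    (fun q => C.horizontalProjector_eq_zero_iff.1 (DFunLike.congr_fun hY q)), lie_zero]
  rfl

theorem act_act (X : SmoothVectorField EP P) :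
    C.horizontalProjector.act (C.horizontalProjector.act X) = C.horizontalProjector.act X :=
  ContMDiffSection.ext fun p => C.horizontalProjector_idem p (X p)

/-- The Nijenhuis tensor of the horizontal projector is the vertical part of `[h X, h Y]`. -/
theorem nijenhuis_horizontalProjector (X Y : SmoothVectorField EP P) :
    C.horizontalProjector.nijenhuis X Y =
      ⁅C.horizontalProjector.act X, C.horizontalProjector.act Y⁆ -
        C.horizontalProjector.act
          ⁅C.horizontalProjector.act X, C.horizontalProjector.act Y⁆ := by
  have hv : ∀ Z : SmoothVectorField EP P,
      C.horizontalProjector.act (Z - C.horizontalProjector.act Z) = 0 := fun Z => by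
    rw [SmoothEndomorphismField.act_sub, act_act, sub_self]
  have h := C.act_lie_eq_zero (hv X) (hv Y)
  -- The expansion of `h[X - hX, Y - hY]` is exactly the difference of the two sides of the goal.
  simp only [sub_lie, lie_sub, SmoothEndomorphismField.act_sub] at h
  rw [SmoothEndomorphismField.nijenhuis, act_act, ← sub_eq_zero, ← h]
  abel

theorem metallicStructure_act (a b : ℕ+) (X : SmoothVectorField EP P) :
    (C.metallicStructure a b).tensor.act X = metallicRatio a b • X +
      (a - 2 * metallicRatio a b) • C.horizontalProjector.act X := by
  ext p
  change ((a : ℝ) / 2) • X p + ((2 * metallicRatio a b - a) / 2) •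
    ((X p - C.horizontalProjector p (X p)) - C.horizontalProjector p (X p)) =
    metallicRatio a b • X p + (a - 2 * metallicRatio a b) • C.horizontalProjector p (X p)
  module

theorem metallicStructure_isIntegrable_iff (a b : ℕ+) :
    (C.metallicStructure a b).IsIntegrable ↔
      ∀ X Y : SmoothVectorField EP P, C.horizontalProjector.nijenhuis X Y = 0 := by
  -- `a - 2ρ = -√(a² + 4b)`.
  have hne : ((a : ℝ) - 2 * metallicRatio a b) ^ 2 ≠ 0 := by
    have : 0 < √((a : ℝ) ^ 2 + 4 * (b : ℝ)) := Real.sqrt_pos.2 (by positivity)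
    refine pow_ne_zero 2 ?_
    unfold metallicRatio
    linarith
  refine forall₂_congr fun X Y => ?_
  rw [SmoothEndomorphismField.nijenhuis_eq_smul (C.metallicStructure_act a b),
    smul_eq_zero_iff_right hne]

/-- The horizontal lift preserves brackets if and only if the horizontal projector has vanishing
Nijenhuis tensor. -/
theorem lift_lie_iff [T2Space M] :
    (∀ X Y : SmoothVectorField EM M, C.lift ⁅X, Y⁆ = ⁅C.lift X, C.lift Y⁆) ↔
      ∀ X Y : SmoothVectorField EP P, C.horizontalProjector.nijenhuis X Y = 0 := by
  constructor
  · intro h X Y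
    rw [nijenhuis_horizontalProjector]
    ext p
    -- The lifts of `X'` and `Y'` agree with `hX` and `hY` at `p`, though not nearby; tensoriality
    -- makes this enough.
    obtain ⟨X', hX'⟩ := SmoothVectorField.exists_apply_eq (B.proj p) (B.dproj p (X p))
    obtain ⟨Y', hY'⟩ := SmoothVectorField.exists_apply_eq (B.proj p) (B.dproj p (Y p))
    have key : ∀ (Z : SmoothVectorField EP P) (Z' : SmoothVectorField EM M),
        Z' (B.proj p) = B.dproj p (Z p) →
        C.horizontalProjector.act Z p = C.lift Z' p := fun Z Z' hZ => by
      rw [← C.horizontalProjector_lift]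
      exact C.horizontalProjector_eq_of_dproj_eq (by rw [C.dproj_lift, hZ])
    have := C.horizontalProjector.lie_act_eq_of_apply_eq C.horizontalProjector_idem
      (key X X' hX') (key Y Y' hY')
    rw [act_act, act_act, act_lift, act_lift, ← h, C.horizontalProjector_lift, sub_self] at this
    exact this
  · intro h X Y
    have := h (C.lift X) (C.lift Y)
    rw [nijenhuis_horizontalProjector, act_lift, act_lift, act_lie_lift, sub_eq_zero] at this
    exact this.symm

end PrincipalConnection

theorem mainTheorem11 {EM EG EP : Type*}
    [NormedAddCommGroup EM] [NormedSpace ℝ EM] [FiniteDimensional ℝ EM]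
    [NormedAddCommGroup EG] [NormedSpace ℝ EG] [FiniteDimensional ℝ EG]
    [NormedAddCommGroup EP] [NormedSpace ℝ EP] [FiniteDimensional ℝ EP]
    {M G P : Type*}
    [TopologicalSpace M] [ChartedSpace EM M] [IsManifold 𝓘(ℝ, EM) ∞ M] [T2Space M]
    [TopologicalSpace G] [ChartedSpace EG G] [Group G] [LieGroup 𝓘(ℝ, EG) ∞ G]
    [TopologicalSpace P] [ChartedSpace EP P] [IsManifold 𝓘(ℝ, EP) ∞ P]
    [MulAction Gᵐᵒᵖ P]
    (B : PrincipalBundle EM EG EP M G P) (C : PrincipalConnection B) (a b : ℕ+) :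
    (∃ φ : SmoothVectorField EM M →ₗ⁅ℝ⁆ SmoothVectorField EP P, ∀ X, φ X = C.lift X) ↔
      (C.metallicStructure a b).IsIntegrable := by
  -- The lift is always linear, so being a morphism only means preserving brackets.
  rw [C.metallicStructure_isIntegrable_iff, ← C.lift_lie_iff]
  constructor
  · rintro ⟨φ, hφ⟩ X Y
    rw [← hφ, ← hφ, ← hφ, LieHom.map_lie]
  · intro h
    exact ⟨{ toFun := C.lift
             map_add' := C.lift_add
             map_smul' := C.lift_smul
             map_lie' := h _ _ }, fun _ => rfl⟩
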